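/- For a finite connected graph $G$ and $X\subseteq V(G)$, two vertices $u,v$ are called $X$-visible if there is a shortest $u,v$-path $P$ in $G$ with $V(P)\cap X\subseteq\{u,v\}$. The set $X$ is an outer mutual-visibility set of $G$ if every two vertices $u,v\in X$ are $X$-visible and every $u\in X$, $v\in V(G)\setminus X$ are $X$-visible; the outer mutual-visibility number $\mu_{\rm o}(G)$ is the cardinality of a largest outer mutual-visibility set of $G$. Let $P_n\,\square\,P_m$ denote the grid graph, that is, the Cartesian product of the paths on $n$ and on $m$ vertices. Theorem. If $n\ge m\ge 2$, then $$\mu_{\rm o}(P_n\,\square\, P_m) = \begin{cases} 2; & (n,m)=(2,2),\\ 4; & (n,m) \in \{(3,2), (3,3), (4,3), (4,4)\}, \\ 5; & (n,m) \in \{(5,4), (5,5), (6,4)\}, \\ 6; & (n,m)=(6,5), \\ m+2; & \text{otherwise}. \end{cases}$$ -/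

import Mathlib

namespace SimpleGraph

/-- Vertices `u` and `v` are `X`-visible if there is a shortest `u,v`-path whose vertices
in `X` are among `u` and `v`. -/
def XVisible {V : Type*} (G : SimpleGraph V) (X : Set V) (u v : V) : Prop :=
  ∃ p : G.Walk u v, p.IsPath ∧ p.length = G.dist u v ∧
    ∀ w ∈ p.support, w ∈ X → w = u ∨ w = v

/-- `X` is an outer mutual-visibility set: any two vertices of `X` are `X`-visible, and any
vertex of `X` and any vertex outside `X` are `X`-visible. -/
def IsOuterMutualVisibilitySet {V : Type*} (G : SimpleGraph V) (X : Set V) : Prop :=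
  (∀ u ∈ X, ∀ v ∈ X, G.XVisible X u v) ∧ (∀ u ∈ X, ∀ v ∈ Xᶜ, G.XVisible X u v)

/-- The outer mutual-visibility number of a finite graph: the cardinality of a largest outer
mutual-visibility set. The set of cardinalities is bounded (the graph is finite) and nonempty
(the empty set qualifies), so the supremum is attained. -/
noncomputable def outerMutualVisibilityNumber {V : Type*} [Finite V] (G : SimpleGraph V) : ℕ :=
  sSup {k : ℕ | ∃ X : Set V, G.IsOuterMutualVisibilitySet X ∧ X.ncard = k}

/-- The grid graph: the Cartesian product of the paths on `n` and on `m` vertices. -/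
def gridGraph (n m : ℕ) : SimpleGraph (Fin n × Fin m) :=
  pathGraph n □ pathGraph m

end SimpleGraph

-- Visibility from `u` is local: `u` sees everything iff every `v ≠ u` has a neighbour one step
-- closer to `u` that is `u` or outside `X`. In a grid `v` has at most two such predecessors, one
-- horizontal and one vertical, and if there are two they are diagonally adjacent. So two points of
-- `X` on a line must be its ends (`row`, `col`), while diagonally adjacent points of `X` exclude
-- further points from two quadrants (`diagonal`, `antidiagonal`). The line conditions alone give
-- `ncard_le`, the bound `m + 2`. It is attained by the four corners and one point in each inner
-- row, provided no columns clash and no two points are diagonally adjacent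
-- (`isOuterMutualVisibilitySet_of_sparse`). Such points fit except in small grids, where a
-- row-by-row search using the necessary conditions gives the upper bound.

namespace SimpleGraph

-- Visibility as a one-step condition

section General

variable {V : Type*} {G : SimpleGraph V} {X : Set V} {u v : V}

/-- If `u` and a different vertex `v` are `X`-visible, then `v` has a neighbour one step closer
to `u` that does not block. -/
theorem XVisible.exists_closer_neighbor (h : G.XVisible X u v) (huv : u ≠ v) :
    ∃ w, G.Adj w v ∧ G.dist u w + 1 = G.dist u v ∧ (w ∉ X ∨ w = u) := by
  obtain ⟨p, hp, hlen, hX⟩ := h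
  have hnil : ¬ p.Nil := Walk.not_nil_of_ne huv
  have hadj := p.adj_penultimate hnil
  have hle : G.dist u p.penultimate ≤ p.dropLast.length := dist_le _
  have hdl : p.dropLast.length + 1 = p.length := Walk.length_dropLast_add_one hnil
  have hr : G.Reachable u p.penultimate := ⟨p.dropLast⟩
  have hge : G.dist u v ≤ G.dist u p.penultimate + 1 := by
    obtain ⟨q, hq⟩ := hr.exists_walk_length_eq_dist
    have := dist_le (q.concat hadj)
    rw [Walk.length_concat] at this
    omega
  refine ⟨p.penultimate, hadj, by omega, ?_⟩
  by_cases hw : p.penultimate ∈ X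
  · exact Or.inr ((hX _ (p.getVert_mem_support _) hw).resolve_right hadj.ne)
  · exact Or.inl hw

/-- If every vertex other than `u` has a non-blocking neighbour one step closer to `u`, then
`u` sees every vertex. -/
theorem xVisible_of_exists_closer_neighbor
    (h : ∀ v, v ≠ u → ∃ w, G.Adj w v ∧ G.dist u w + 1 = G.dist u v ∧ (w ∉ X ∨ w = u)) (v : V) :
    G.XVisible X u v := by
  induction hd : G.dist u v generalizing v with
  | zero =>
    by_cases huv : v = u
    · subst huv
      exact ⟨Walk.nil, by simp, by simp, by simp⟩
    · obtain ⟨w, -, hw, -⟩ := h v huv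
      omega
  | succ d ih =>
    have huv : v ≠ u := by
      rintro rfl
      simp at hd
    obtain ⟨w, hadj, hw, hwX⟩ := h v huv
    obtain ⟨p, -, hlen, hX⟩ := ih w (by omega)
    have hl : (p.concat hadj).length = G.dist u v := by rw [Walk.length_concat]; omega
    refine ⟨p.concat hadj, Walk.isPath_of_length_eq_dist _ hl, hl, fun x hx hxX => ?_⟩
    rw [Walk.support_concat, List.mem_append, List.mem_singleton] at hx
    rcases hx with hx | hx
    · rcases hX x hx hxX with h1 | rfl
      · exact Or.inl h1
      · exact Or.inl (hwX.resolve_left (not_not.2 hxX))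
    · exact Or.inr hx

theorem isOuterMutualVisibilitySet_iff :
    G.IsOuterMutualVisibilitySet X ↔ ∀ u ∈ X, ∀ v, G.XVisible X u v := by
  constructor
  · rintro ⟨h1, h2⟩ u hu v
    by_cases hv : v ∈ X
    · exact h1 u hu v hv
    · exact h2 u hu v hv
  · exact fun h => ⟨fun u hu v _ => h u hu v, fun u hu v _ => h u hu v⟩

end General

-- Distances and predecessors in grids

theorem dist_pathGraph {n : ℕ} (a b : Fin n) :
    (pathGraph n).dist a b = ((a : ℤ) - b).natAbs := by
  have hr : (pathGraph n).Reachable a b := pathGraph_preconnected n a b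
  apply le_antisymm
  · induction hd : ((a : ℤ) - b).natAbs generalizing b with
    | zero =>
      have : a = b := Fin.ext (by omega)
      simp [this]
    | succ d ih =>
      obtain ⟨c, hc, hcb⟩ : ∃ c : Fin n, ((a : ℤ) - c).natAbs = d ∧ (pathGraph n).Adj c b := by
        rcases lt_or_ge (a : ℕ) b with h | h
        · exact ⟨⟨(b : ℕ) - 1, by omega⟩, by simp only; omega, by rw [pathGraph_adj]; simp only; omega⟩
        · exact ⟨⟨(b : ℕ) + 1, by omega⟩, by simp only; omega, by rw [pathGraph_adj]; grind⟩
      have hac : (pathGraph n).Reachable a c := pathGraph_preconnected n a c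
      have := ih c hac hc
      obtain ⟨q, hq⟩ := hac.exists_walk_length_eq_dist
      have h2 := dist_le (q.concat hcb)
      rw [Walk.length_concat] at h2
      omega
  · obtain ⟨p, hp⟩ := hr.exists_walk_length_eq_dist
    rw [← hp]
    clear hp hr
    induction p with
    | nil => simp
    | cons h p ih =>
      rw [pathGraph_adj] at h
      rw [Walk.length_cons]
      omega

theorem dist_gridGraph {n m : ℕ} (u v : Fin n × Fin m) :
    (gridGraph n m).dist u v =
      ((u.1 : ℤ) - v.1).natAbs + ((u.2 : ℤ) - v.2).natAbs := by
  rw [← dist_pathGraph, ← dist_pathGraph, gridGraph, dist, edist_boxProd, ENat.toNat_add]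
  · rfl
  · exact edist_ne_top_iff_reachable.2 (pathGraph_preconnected n _ _)
  · exact edist_ne_top_iff_reachable.2 (pathGraph_preconnected m _ _)

/-- The vertex `w` precedes `v` on some shortest path from `u` to `v` in a grid. -/
def GridStep {n m : ℕ} (u w v : Fin n × Fin m) : Prop :=
  (w.2 : ℕ) = v.2 ∧ ((w.1 : ℕ) + 1 = v.1 ∧ (u.1 : ℕ) ≤ w.1 ∨
      (v.1 : ℕ) + 1 = w.1 ∧ (w.1 : ℕ) ≤ u.1) ∨
    (w.1 : ℕ) = v.1 ∧ ((w.2 : ℕ) + 1 = v.2 ∧ (u.2 : ℕ) ≤ w.2 ∨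
      (v.2 : ℕ) + 1 = w.2 ∧ (w.2 : ℕ) ≤ u.2)

theorem gridStep_iff {n m : ℕ} {u w v : Fin n × Fin m} :
    GridStep u w v ↔ (gridGraph n m).Adj w v ∧
      (gridGraph n m).dist u w + 1 = (gridGraph n m).dist u v := by
  rw [dist_gridGraph, dist_gridGraph, gridGraph, boxProd_adj, pathGraph_adj, pathGraph_adj,
    GridStep, Fin.ext_iff, Fin.ext_iff]
  omega

-- Necessary conditions and a sufficient one

section Grid

variable {n m : ℕ} {X : Set (Fin n × Fin m)}

/-- Removes walks altogether: what remains is arithmetic on the coordinates of predecessors. -/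
theorem isOuterMutualVisibilitySet_gridGraph_iff :
    (gridGraph n m).IsOuterMutualVisibilitySet X ↔
      ∀ u ∈ X, ∀ v, v ≠ u → ∃ w, GridStep u w v ∧ (w ∉ X ∨ w = u) := by
  rw [isOuterMutualVisibilitySet_iff]
  simp only [gridStep_iff, and_assoc]
  exact ⟨fun h u hu v hv => (h u hu v).exists_closer_neighbor hv.symm,
    fun h u hu => xVisible_of_exists_closer_neighbor (h u hu)⟩

namespace IsOuterMutualVisibilitySet

/-- Two vertices of an outer mutual-visibility set in a common row are the ends of the row. -/
theorem row (h : (gridGraph n m).IsOuterMutualVisibilitySet X) {p q : Fin n × Fin m}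
    (hp : p ∈ X) (hq : q ∈ X) (hpq : (p.2 : ℕ) = q.2) (hlt : (p.1 : ℕ) < q.1) :
    (p.1 : ℕ) = 0 ∧ (q.1 : ℕ) + 1 = n := by
  rw [isOuterMutualVisibilitySet_gridGraph_iff] at h
  constructor
  · by_contra h0
    -- Seen from `q`, the vertex just beyond `p` has `p` as its only predecessor.
    obtain ⟨w, hw, hwX⟩ := h q hq (⟨p.1 - 1, by omega⟩, p.2) (by
      simp only [ne_eq, Prod.ext_iff, Fin.ext_iff]; omega)
    have : w = p := by
      simp only [GridStep] at hw
      exact Prod.ext (Fin.ext (by omega)) (Fin.ext (by omega))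
    subst this
    rcases hwX with hwX | rfl
    · exact hwX hp
    · omega
  · by_contra h0
    obtain ⟨w, hw, hwX⟩ := h p hp (⟨q.1 + 1, by omega⟩, p.2) (by
      simp only [ne_eq, Prod.ext_iff, Fin.ext_iff]; omega)
    have : w = q := by
      simp only [GridStep] at hw
      exact Prod.ext (Fin.ext (by omega)) (Fin.ext (by omega))
    subst this
    rcases hwX with hwX | rfl
    · exact hwX hq
    · omega

/-- Two vertices of an outer mutual-visibility set in a common column are the ends of the
column. -/
theorem col (h : (gridGraph n m).IsOuterMutualVisibilitySet X) {p q : Fin n × Fin m}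
    (hp : p ∈ X) (hq : q ∈ X) (hpq : (p.1 : ℕ) = q.1) (hlt : (p.2 : ℕ) < q.2) :
    (p.2 : ℕ) = 0 ∧ (q.2 : ℕ) + 1 = m := by
  rw [isOuterMutualVisibilitySet_gridGraph_iff] at h
  constructor
  · by_contra h0
    obtain ⟨w, hw, hwX⟩ := h q hq (p.1, ⟨p.2 - 1, by omega⟩) (by
      simp only [ne_eq, Prod.ext_iff, Fin.ext_iff]; omega)
    have : w = p := by
      simp only [GridStep] at hw
      exact Prod.ext (Fin.ext (by omega)) (Fin.ext (by omega))
    subst this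
    rcases hwX with hwX | rfl
    · exact hwX hp
    · omega
  · by_contra h0
    obtain ⟨w, hw, hwX⟩ := h p hp (p.1, ⟨q.2 + 1, by omega⟩) (by
      simp only [ne_eq, Prod.ext_iff, Fin.ext_iff]; omega)
    have : w = q := by
      simp only [GridStep] at hw
      exact Prod.ext (Fin.ext (by omega)) (Fin.ext (by omega))
    subst this
    rcases hwX with hwX | rfl
    · exact hwX hq
    · omega

/-- A vertex `u` of an outer mutual-visibility set `X` cannot be separated from `v` by two
vertices of `X` that are its only possible predecessors. -/
theorem not_blocked (h : (gridGraph n m).IsOuterMutualVisibilitySet X)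
    {p q u v : Fin n × Fin m} (hp : p ∈ X) (hq : q ∈ X) (hu : u ∈ X)
    (hpu : p ≠ u) (hqu : q ≠ u) (hvu : v ≠ u)
    (hw : ∀ w, GridStep u w v → w = p ∨ w = q) : False := by
  rw [isOuterMutualVisibilitySet_gridGraph_iff] at h
  obtain ⟨w, hwv, hwX⟩ := h u hu v hvu
  rcases hw w hwv with rfl | rfl
  · exact hwX.elim (fun h => h hp) hpu
  · exact hwX.elim (fun h => h hq) hqu

/-- Two vertices of an outer mutual-visibility set adjacent along an antidiagonal exclude
further vertices from two opposite quadrants. -/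
theorem antidiagonal (h : (gridGraph n m).IsOuterMutualVisibilitySet X)
    {p q u : Fin n × Fin m} (hp : p ∈ X) (hq : q ∈ X) (hu : u ∈ X)
    (h1 : (p.1 : ℕ) + 1 = q.1) (h2 : (q.2 : ℕ) + 1 = p.2) :
    ¬ ((u.1 : ℕ) ≤ p.1 ∧ (u.2 : ℕ) ≤ q.2) ∧ ¬ ((q.1 : ℕ) ≤ u.1 ∧ (p.2 : ℕ) ≤ u.2) := by
  constructor <;> rintro ⟨h3, h4⟩
  -- `v` is the corner, farthest from `u`, of the unit square with diagonal `p`, `q`; these are its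
  -- only predecessors.
  · refine h.not_blocked (v := (q.1, p.2)) hp hq hu ?_ ?_ ?_ fun w hw => ?_
    iterate 3 simp only [ne_eq, Prod.ext_iff, Fin.ext_iff]; omega
    simp only [GridStep] at hw
    simp only [Prod.ext_iff, Fin.ext_iff]
    omega
  · refine h.not_blocked (v := (p.1, q.2)) hp hq hu ?_ ?_ ?_ fun w hw => ?_
    iterate 3 simp only [ne_eq, Prod.ext_iff, Fin.ext_iff]; omega
    simp only [GridStep] at hw
    simp only [Prod.ext_iff, Fin.ext_iff]
    omega

/-- Two vertices of an outer mutual-visibility set adjacent along a diagonal exclude further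
vertices from two opposite quadrants. -/
theorem diagonal (h : (gridGraph n m).IsOuterMutualVisibilitySet X)
    {p q u : Fin n × Fin m} (hp : p ∈ X) (hq : q ∈ X) (hu : u ∈ X)
    (h1 : (p.1 : ℕ) + 1 = q.1) (h2 : (p.2 : ℕ) + 1 = q.2) :
    ¬ ((u.1 : ℕ) ≤ p.1 ∧ (q.2 : ℕ) ≤ u.2) ∧ ¬ ((q.1 : ℕ) ≤ u.1 ∧ (u.2 : ℕ) ≤ p.2) := by
  constructor <;> rintro ⟨h3, h4⟩
  · refine h.not_blocked (v := (q.1, p.2)) hp hq hu ?_ ?_ ?_ fun w hw => ?_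
    iterate 3 simp only [ne_eq, Prod.ext_iff, Fin.ext_iff]; omega
    simp only [GridStep] at hw
    simp only [Prod.ext_iff, Fin.ext_iff]
    omega
  · refine h.not_blocked (v := (p.1, q.2)) hp hq hu ?_ ?_ ?_ fun w hw => ?_
    iterate 3 simp only [ne_eq, Prod.ext_iff, Fin.ext_iff]; omega
    simp only [GridStep] at hw
    simp only [Prod.ext_iff, Fin.ext_iff]
    omega

end IsOuterMutualVisibilitySet

/-- A set of grid vertices such that any two of them in a common row or column are its ends and
no two of them are diagonally adjacent is an outer mutual-visibility set. -/
theorem isOuterMutualVisibilitySet_of_sparse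
    (hrow : ∀ p ∈ X, ∀ q ∈ X, (p.2 : ℕ) = q.2 → (p.1 : ℕ) < q.1 →
      (p.1 : ℕ) = 0 ∧ (q.1 : ℕ) + 1 = n)
    (hcol : ∀ p ∈ X, ∀ q ∈ X, (p.1 : ℕ) = q.1 → (p.2 : ℕ) < q.2 →
      (p.2 : ℕ) = 0 ∧ (q.2 : ℕ) + 1 = m)
    (hdiag : ∀ p ∈ X, ∀ q ∈ X, (p.1 : ℕ) + 1 = q.1 →
      (p.2 : ℕ) + 1 ≠ q.2 ∧ (q.2 : ℕ) + 1 ≠ p.2) :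
    (gridGraph n m).IsOuterMutualVisibilitySet X := by
  rw [isOuterMutualVisibilitySet_gridGraph_iff]
  intro u hu v hvu
  by_contra! hcon
  simp only [ne_eq, Prod.ext_iff, Fin.ext_iff] at hvu
  have key : ∀ w, GridStep u w v → w ∈ X := fun w hw => (hcon w hw).1
  have keyne : ∀ w, GridStep u w v → w ≠ u := fun w hw => (hcon w hw).2
  have hu1 := u.1.isLt
  have hu2 := u.2.isLt
  have hv1 := v.1.isLt
  have hv2 := v.2.isLt
  have hh : ∀ a : Fin n, ((v.1 : ℕ) = (a : ℕ) + 1 ∧ (u.1 : ℕ) ≤ a ∨ (v.1 : ℕ) + 1 = a ∧ (a : ℕ) ≤ u.1) →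
      (a, v.2) ∈ X ∧ ((a : ℕ) ≠ u.1 ∨ (v.2 : ℕ) ≠ u.2) := by
    intro a ha
    have hs : GridStep u (a, v.2) v := by grind [GridStep]
    refine ⟨key _ hs, ?_⟩
    have := keyne _ hs
    simp only [ne_eq, Prod.ext_iff, Fin.ext_iff] at this
    omega
  have hk : ∀ b : Fin m, ((v.2 : ℕ) = (b : ℕ) + 1 ∧ (u.2 : ℕ) ≤ b ∨ (v.2 : ℕ) + 1 = b ∧ (b : ℕ) ≤ u.2) →
      (v.1, b) ∈ X ∧ ((v.1 : ℕ) ≠ u.1 ∨ (b : ℕ) ≠ u.2) := by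
    intro b hb
    have hs : GridStep u (v.1, b) v := by grind [GridStep]
    refine ⟨key _ hs, ?_⟩
    have := keyne _ hs
    simp only [ne_eq, Prod.ext_iff, Fin.ext_iff] at this
    omega
  have hx : (v.1 : ℕ) = u.1 ∨ ∃ a : Fin n,
      ((v.1 : ℕ) = (a : ℕ) + 1 ∧ (u.1 : ℕ) ≤ a ∨ (v.1 : ℕ) + 1 = a ∧ (a : ℕ) ≤ u.1) := by
    rcases lt_trichotomy (v.1 : ℕ) u.1 with h | h | h
    · exact Or.inr ⟨⟨(v.1 : ℕ) + 1, by omega⟩, by grind⟩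
    · exact Or.inl h
    · exact Or.inr ⟨⟨(v.1 : ℕ) - 1, by omega⟩, by grind⟩
  have hy : (v.2 : ℕ) = u.2 ∨ ∃ b : Fin m,
      ((v.2 : ℕ) = (b : ℕ) + 1 ∧ (u.2 : ℕ) ≤ b ∨ (v.2 : ℕ) + 1 = b ∧ (b : ℕ) ≤ u.2) := by
    rcases lt_trichotomy (v.2 : ℕ) u.2 with h | h | h
    · exact Or.inr ⟨⟨(v.2 : ℕ) + 1, by omega⟩, by grind⟩
    · exact Or.inl h
    · exact Or.inr ⟨⟨(v.2 : ℕ) - 1, by omega⟩, by grind⟩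
  -- On a common line with `u`, the predecessor of `v` lies in `X` and would be an end of that line,
  -- yet `v` lies beyond it. Otherwise both predecessors lie in `X` and are diagonally adjacent.
  rcases hx with hx | ⟨a, ha⟩ <;> rcases hy with hy | ⟨b, hb⟩
  · omega
  · obtain ⟨hX, hne⟩ := hk b hb
    have h1 := hcol _ hX u hu
    have h2 := hcol u hu _ hX
    simp only at h1 h2
    omega
  · obtain ⟨hX, hne⟩ := hh a ha
    have h1 := hrow _ hX u hu
    have h2 := hrow u hu _ hX
    simp only at h1 h2
    omega
  · have h1 := hdiag _ (hh a ha).1 _ (hk b hb).1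
    have h2 := hdiag _ (hk b hb).1 _ (hh a ha).1
    simp only at h1 h2
    omega

end Grid

/-- Two points in a row include one in the last column, so each row has at most one point off that
column; the last column itself contains at most its two ends. -/
theorem IsOuterMutualVisibilitySet.ncard_le {n m : ℕ} {X : Set (Fin n × Fin m)}
    (h : (gridGraph n m).IsOuterMutualVisibilitySet X) : X.ncard ≤ m + 2 := by
  have hX : X = {p ∈ X | (p.1 : ℕ) + 1 ≠ n} ∪ {p ∈ X | (p.1 : ℕ) + 1 = n} := by
    ext p
    simp only [Set.mem_union, Set.mem_ofPred_eq]
    tauto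
  have h1 : {p ∈ X | (p.1 : ℕ) + 1 ≠ n}.ncard ≤ m := by
    have := Set.ncard_le_ncard_of_injOn (s := {p ∈ X | (p.1 : ℕ) + 1 ≠ n})
      (t := (Set.univ : Set (Fin m))) Prod.snd (fun _ _ => Set.mem_univ _) (by
        rintro p ⟨hp, hp'⟩ q ⟨hq, hq'⟩ hpq
        have a := h.row hp hq (congrArg Fin.val hpq)
        have b := h.row hq hp (congrArg Fin.val hpq.symm)
        exact Prod.ext (Fin.ext (by omega)) hpq) Set.finite_univ
    simpa [Set.ncard_univ] using this
  have h2 : {p ∈ X | (p.1 : ℕ) + 1 = n}.ncard ≤ 2 := by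
    have := Set.ncard_le_ncard_of_injOn (s := {p ∈ X | (p.1 : ℕ) + 1 = n})
      (t := (Set.univ : Set Bool)) (fun p => decide ((p.2 : ℕ) = 0))
      (fun _ _ => Set.mem_univ _) (by
        rintro p ⟨hp, hp'⟩ q ⟨hq, hq'⟩ hpq
        have hpq' := decide_eq_decide.1 hpq
        have a := h.col hp hq (by omega)
        have b := h.col hq hp (by omega)
        exact Prod.ext (Fin.ext (by omega)) (Fin.ext (by omega))) Set.finite_univ
    simpa [Set.ncard_univ] using this
  rw [hX]
  exact (Set.ncard_union_le _ _).trans (add_le_add h1 h2)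

-- Exhaustive search for small grids

/-- The necessary conditions on the coordinates of an outer mutual-visibility set of a grid
with `m` rows that relate points in different rows. -/
def Admissible (m : ℕ) (L : List (ℕ × ℕ)) : Prop :=
  ∀ p ∈ L, ∀ q ∈ L, (p.1 = q.1 → p.2 < q.2 → p.2 = 0 ∧ q.2 + 1 = m) ∧
    (p.1 + 1 = q.1 → ∀ u ∈ L,
      (q.2 + 1 = p.2 → ¬ (u.1 ≤ p.1 ∧ u.2 ≤ q.2) ∧ ¬ (q.1 ≤ u.1 ∧ p.2 ≤ u.2)) ∧
      (p.2 + 1 = q.2 → ¬ (u.1 ≤ p.1 ∧ q.2 ≤ u.2) ∧ ¬ (q.1 ≤ u.1 ∧ u.2 ≤ p.2)))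

set_option synthInstance.maxSize 1000 in
instance (m : ℕ) (L : List (ℕ × ℕ)) : Decidable (Admissible m L) := by
  unfold Admissible
  infer_instance

/-- The possible intersections of an outer mutual-visibility set with row `y` of a grid with
`n` columns. -/
def rowChoices (n y : ℕ) : List (List (ℕ × ℕ)) :=
  [] :: [(0, y), (n - 1, y)] :: (List.range n).map fun x => [(x, y)]

/-- Whether `L` extends, by points in the rows below `y`, to an admissible list of length at
least `k`. -/
def canExtend (n m k : ℕ) : ℕ → List (ℕ × ℕ) → Bool
  | 0, L => decide (k ≤ L.length)
  | y + 1, L => (rowChoices n y).any fun r =>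
      -- Pruning: each of the `y` remaining rows adds at most two points.
      decide (k ≤ (r ++ L).length + 2 * y) && decide (Admissible m (r ++ L)) &&
        canExtend n m k y (r ++ L)

section Search

variable {n m : ℕ} {T : Finset (ℕ × ℕ)}

theorem exists_rowChoice (hlt : ∀ p ∈ T, p.1 < n)
    (hrow : ∀ p ∈ T, ∀ q ∈ T, p.2 = q.2 → p.1 < q.1 → p.1 = 0 ∧ q.1 + 1 = n) (y : ℕ) :
    ∃ r ∈ rowChoices n y, (∀ p ∈ r, p ∈ T) ∧ r.length = (T.filter (·.2 = y)).card := by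
  rcases Nat.lt_or_ge 1 (T.filter (·.2 = y)).card with h | h
  · obtain ⟨a, ha, b, hb, hab⟩ := Finset.one_lt_card.1 h
    wlog hlt' : a.1 < b.1 generalizing a b
    · refine this b hb a ha hab.symm ?_
      have : a.1 ≠ b.1 := fun he => hab (Prod.ext he
        ((Finset.mem_filter.1 ha).2.trans (Finset.mem_filter.1 hb).2.symm))
      omega
    simp only [Finset.mem_filter] at ha hb
    have h0 := hrow a ha.1 b hb.1 (ha.2.trans hb.2.symm) hlt'
    have ha' : a = (0, y) := Prod.ext h0.1 ha.2
    have hb' : b = (n - 1, y) := Prod.ext (by simp only; omega) hb.2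
    refine ⟨[(0, y), (n - 1, y)], by simp [rowChoices], ?_, ?_⟩
    · rw [← ha', ← hb']
      simp [ha.1, hb.1]
    · have : T.filter (·.2 = y) = {a, b} := by
        ext c
        simp only [Finset.mem_filter, Finset.mem_insert, Finset.mem_singleton]
        constructor
        · rintro ⟨hc, hcy⟩
          have h1 := hrow a ha.1 c hc (by omega)
          have h2 := hrow c hc b hb.1 (by omega)
          have h3 := hrow b hb.1 c hc (by omega)
          simp only [Prod.ext_iff]
          omega
        · rintro (rfl | rfl)
          exacts [ha, hb]
      rw [this, Finset.card_pair hab]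
      rfl
  · rcases Nat.eq_zero_or_pos (T.filter (·.2 = y)).card with h0 | h0
    · exact ⟨[], by simp [rowChoices], by simp, h0.symm⟩
    · obtain ⟨a, ha⟩ := Finset.card_pos.1 h0
      simp only [Finset.mem_filter] at ha
      refine ⟨[a], ?_, by simp [ha.1], by rw [List.length_singleton]; omega⟩
      simp only [rowChoices, List.mem_cons, List.mem_map, List.mem_range]
      exact Or.inr (Or.inr ⟨a.1, hlt a ha.1, by rw [← ha.2]⟩)

theorem card_filter_lt_succ (y : ℕ) :
    (T.filter (·.2 < y + 1)).card = (T.filter (·.2 < y)).card + (T.filter (·.2 = y)).card := by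
  rw [← Finset.card_union_of_disjoint]
  · congr 1
    ext p
    simp only [Finset.mem_filter, Finset.mem_union, Nat.lt_succ_iff_lt_or_eq]
    tauto
  · rw [Finset.disjoint_left]
    intro p hp hq
    simp only [Finset.mem_filter] at hp hq
    omega

theorem length_le_two_of_mem_rowChoices {y : ℕ} {r : List (ℕ × ℕ)} (h : r ∈ rowChoices n y) :
    r.length ≤ 2 := by
  simp only [rowChoices, List.mem_cons, List.mem_map] at h
  rcases h with rfl | rfl | ⟨x, -, rfl⟩ <;> simp

theorem card_filter_lt_le (hlt : ∀ p ∈ T, p.1 < n)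
    (hrow : ∀ p ∈ T, ∀ q ∈ T, p.2 = q.2 → p.1 < q.1 → p.1 = 0 ∧ q.1 + 1 = n) (y : ℕ) :
    (T.filter (·.2 < y)).card ≤ 2 * y := by
  induction y with
  | zero => simp
  | succ y ih =>
    obtain ⟨r, hr, -, hl⟩ := exists_rowChoice hlt hrow y
    have := length_le_two_of_mem_rowChoices hr
    rw [card_filter_lt_succ]
    omega

/-- Completeness of the search: choosing the actual row intersections of `T` passes every test,
since admissibility holds for all lists of points of `T`. -/
theorem canExtend_eq_true (hlt : ∀ p ∈ T, p.1 < n)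
    (hrow : ∀ p ∈ T, ∀ q ∈ T, p.2 = q.2 → p.1 < q.1 → p.1 = 0 ∧ q.1 + 1 = n)
    (hadm : ∀ L : List (ℕ × ℕ), (∀ p ∈ L, p ∈ T) → Admissible m L) {k : ℕ} (y : ℕ)
    (L : List (ℕ × ℕ)) (hL : ∀ p ∈ L, p ∈ T)
    (hk : k ≤ L.length + (T.filter (·.2 < y)).card) : canExtend n m k y L = true := by
  induction y generalizing L with
  | zero => simpa [canExtend] using hk
  | succ y ih =>
    obtain ⟨r, hr, hrT, hl⟩ := exists_rowChoice hlt hrow y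
    rw [card_filter_lt_succ] at hk
    have hle := card_filter_lt_le hlt hrow y
    have hrL : ∀ p ∈ r ++ L, p ∈ T := fun p hp =>
      (List.mem_append.1 hp).elim (hrT p) (hL p)
    have hlen : (r ++ L).length = r.length + L.length := List.length_append
    simp only [canExtend, List.any_eq_true, Bool.and_eq_true, decide_eq_true_eq]
    exact ⟨r, hr, ⟨by omega, hadm _ hrL⟩, ih _ hrL (by omega)⟩

end Search

theorem IsOuterMutualVisibilitySet.ncard_lt_of_canExtend {n m k : ℕ} {X : Set (Fin n × Fin m)}
    (h : (gridGraph n m).IsOuterMutualVisibilitySet X) (hk : canExtend n m k m [] = false) :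
    X.ncard < k := by
  by_contra! hle
  let f : Fin n × Fin m → ℕ × ℕ := fun p => (p.1, p.2)
  have hf : Function.Injective f := fun p q hpq =>
    Prod.ext (Fin.ext (congrArg Prod.fst hpq)) (Fin.ext (congrArg Prod.snd hpq))
  let T : Finset (ℕ × ℕ) := X.toFinite.toFinset.image f
  have hT : ∀ p, p ∈ T ↔ ∃ a ∈ X, f a = p := by simp [T]
  have hcard : T.card = X.ncard := by
    rw [Finset.card_image_of_injective _ hf, Set.ncard_eq_toFinset_card]
  have hall : T.filter (·.2 < m) = T := by
    rw [Finset.filter_eq_self]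
    intro p hp
    obtain ⟨a, -, rfl⟩ := (hT p).1 hp
    exact a.2.isLt
  have : canExtend n m k m [] = true := by
    refine canExtend_eq_true (T := T) ?_ ?_ ?_ _ _ (by simp) (by rw [hall, hcard]; omega)
    · intro p hp
      obtain ⟨a, -, rfl⟩ := (hT p).1 hp
      exact a.1.isLt
    · intro p hp q hq
      obtain ⟨a, ha, rfl⟩ := (hT p).1 hp
      obtain ⟨b, hb, rfl⟩ := (hT q).1 hq
      exact h.row ha hb
    · intro L hL p hp q hq
      obtain ⟨a, ha, rfl⟩ := (hT p).1 (hL p hp)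
      obtain ⟨b, hb, rfl⟩ := (hT q).1 (hL q hq)
      refine ⟨h.col ha hb, fun h1 u hu => ?_⟩
      obtain ⟨c, hc, rfl⟩ := (hT u).1 (hL u hu)
      exact ⟨h.antidiagonal ha hb hc h1, h.diagonal ha hb hc h1⟩
  simp [hk] at this

-- Constructions and values

section Number

variable {n m k : ℕ}

theorem outerMutualVisibilityNumber_le
    (h : ∀ X, (gridGraph n m).IsOuterMutualVisibilitySet X → X.ncard ≤ k) :
    (gridGraph n m).outerMutualVisibilityNumber ≤ k := by
  refine csSup_le' ?_
  rintro _ ⟨X, hX, rfl⟩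
  exact h X hX

theorem outerMutualVisibilityNumber_le_of_canExtend (h : canExtend n m (k + 1) m [] = false) :
    (gridGraph n m).outerMutualVisibilityNumber ≤ k :=
  outerMutualVisibilityNumber_le fun _ hX => Nat.lt_succ_iff.1 (hX.ncard_lt_of_canExtend h)

theorem le_outerMutualVisibilityNumber (S : Finset (Fin n × Fin m)) (hk : k ≤ S.card)
    (hS : ∀ p ∈ S, ∀ q ∈ S,
      ((p.2 : ℕ) = q.2 → (p.1 : ℕ) < q.1 → (p.1 : ℕ) = 0 ∧ (q.1 : ℕ) + 1 = n) ∧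
      ((p.1 : ℕ) = q.1 → (p.2 : ℕ) < q.2 → (p.2 : ℕ) = 0 ∧ (q.2 : ℕ) + 1 = m) ∧
      ((p.1 : ℕ) + 1 = q.1 → (p.2 : ℕ) + 1 ≠ q.2 ∧ (q.2 : ℕ) + 1 ≠ p.2)) :
    k ≤ (gridGraph n m).outerMutualVisibilityNumber := by
  -- The supremum in `ℕ` needs a bound on the cardinalities, supplied by `ncard_le`.
  refine hk.trans (le_csSup ⟨m + 2, ?_⟩ ⟨(S : Set (Fin n × Fin m)), ?_, Set.ncard_coe_finset S⟩)
  · rintro _ ⟨X, hX, rfl⟩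
    exact hX.ncard_le
  · exact isOuterMutualVisibilitySet_of_sparse (fun p hp q hq => (hS p hp q hq).1)
      (fun p hp q hq => (hS p hp q hq).2.1) (fun p hp q hq => (hS p hp q hq).2.2)

/-- The four corners together with a suitable vertex in each inner row form an outer
mutual-visibility set. -/
theorem add_two_le_outerMutualVisibilityNumber (hn : 3 ≤ n) (hm : 2 ≤ m) (f : ℕ → ℕ)
    (hb : ∀ y, 0 < y → y + 1 < m → 0 < f y ∧ f y + 1 < n)
    (hinj : ∀ y z, 0 < y → y < z → z + 1 < m → f y ≠ f z)
    (hstep : ∀ y z, 0 < y → y + 1 = z → z + 1 < m → f y + 1 ≠ f z ∧ f z + 1 ≠ f y)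
    (hend : ∀ y, 0 < y → y + 1 < m → y = 1 ∨ y + 2 = m → f y ≠ 1 ∧ f y + 2 ≠ n) :
    m + 2 ≤ (gridGraph n m).outerMutualVisibilityNumber := by
  -- `g` picks one point per row, in column 0 for the two outer rows; `c` and `d` are the other two
  -- corners.
  let g : Fin m → Fin n × Fin m := fun y =>
    (if h : 0 < (y : ℕ) ∧ (y : ℕ) + 1 < m then ⟨f y, by have := hb y h.1 h.2; omega⟩
      else ⟨0, by omega⟩, y)
  have hg : Function.Injective g := fun y z h => congrArg Prod.snd h
  let c : Fin n × Fin m := (⟨n - 1, by omega⟩, ⟨0, by omega⟩)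
  let d : Fin n × Fin m := (⟨n - 1, by omega⟩, ⟨m - 1, by omega⟩)
  have hgval : ∀ y, ((g y).2 : ℕ) = y ∧ (((g y).1 : ℕ) = 0 ∧ ((y : ℕ) = 0 ∨ (y : ℕ) + 1 = m) ∨
      0 < (y : ℕ) ∧ (y : ℕ) + 1 < m ∧ ((g y).1 : ℕ) = f y) := by
    intro y
    refine ⟨rfl, ?_⟩
    by_cases h : 0 < (y : ℕ) ∧ (y : ℕ) + 1 < m
    · exact Or.inr ⟨h.1, h.2, by simp only [g, dif_pos h]⟩
    · exact Or.inl ⟨by simp only [g, dif_neg h], by omega⟩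
  have hglast : ∀ y, ((g y).1 : ℕ) ≠ n - 1 := by
    intro y
    have := hgval y
    have := hb y
    omega
  have hd : d ∉ Finset.univ.image g := by
    simp only [Finset.mem_image, Finset.mem_univ, true_and, not_exists]
    exact fun y hy => hglast y (by rw [hy])
  have hc : c ∉ insert d (Finset.univ.image g) := by
    simp only [Finset.mem_insert, Finset.mem_image, Finset.mem_univ, true_and, not_or, not_exists]
    refine ⟨fun h => ?_, fun y hy => hglast y (by rw [hy])⟩
    have : (0 : ℕ) = m - 1 := congrArg (fun p => (p.2 : ℕ)) h
    omega
  have hcard : (insert c (insert d (Finset.univ.image g))).card = m + 2 := by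
    rw [Finset.card_insert_of_notMem hc, Finset.card_insert_of_notMem hd,
      Finset.card_image_of_injective _ hg, Finset.card_univ, Fintype.card_fin]
  have hmem : ∀ p ∈ insert c (insert d (Finset.univ.image g)),
      (((p.1 : ℕ) = 0 ∨ (p.1 : ℕ) + 1 = n) ∧ ((p.2 : ℕ) = 0 ∨ (p.2 : ℕ) + 1 = m)) ∨
        0 < (p.2 : ℕ) ∧ (p.2 : ℕ) + 1 < m ∧ (p.1 : ℕ) = f p.2 := by
    intro p hp
    simp only [Finset.mem_insert, Finset.mem_image, Finset.mem_univ, true_and] at hp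
    rcases hp with rfl | rfl | ⟨y, rfl⟩
    · exact Or.inl ⟨Or.inr (by simp only [c]; omega), Or.inl rfl⟩
    · exact Or.inl ⟨Or.inr (by simp only [d]; omega), Or.inr (by simp only [d]; omega)⟩
    · obtain ⟨h1, h2⟩ := hgval y
      rw [h1]
      omega
  refine le_outerMutualVisibilityNumber _ hcard.ge fun p hp q hq => ?_
  have b1 := hb p.2
  have b2 := hb q.2
  have e1 := hend p.2
  have e2 := hend q.2
  have hp1 := p.1.isLt
  have hq1 := q.1.isLt
  rcases hmem p hp with ⟨hp', hp''⟩ | ⟨hp0, hpm, hpf⟩ <;>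
    rcases hmem q hq with ⟨hq', hq''⟩ | ⟨hq0, hqm, hqf⟩
  -- For two corners, `3 ≤ n` prevents the first and last columns from being adjacent.
  · omega
  · have b := b2 hq0 hqm
    have e := e2 hq0 hqm
    rw [← hqf] at b e
    omega
  · have b := b1 hp0 hpm
    have e := e1 hp0 hpm
    rw [← hpf] at b e
    omega
  · have i := hinj p.2 q.2 hp0
    have s1 := hstep p.2 q.2 hp0
    have s2 := hstep q.2 p.2 hq0
    have hf : (p.2 : ℕ) = q.2 → f p.2 = f q.2 := congrArg f
    omega

/-- For `k ≥ 4` there is a permutation of `1, …, k` in which consecutive entries are not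
consecutive numbers and which neither starts nor ends with `1` or `k`. -/
theorem exists_spread_permutation (k : ℕ) (hk : 4 ≤ k) : ∃ f : ℕ → ℕ,
    (∀ y, 0 < y → y ≤ k → 0 < f y ∧ f y ≤ k) ∧
    (∀ y z, 0 < y → y < z → z ≤ k → f y ≠ f z) ∧
    (∀ y z, 0 < y → y + 1 = z → z ≤ k → f y + 1 ≠ f z ∧ f z + 1 ≠ f y) ∧
    (∀ y, 0 < y → y ≤ k → y = 1 ∨ y = k → f y ≠ 1 ∧ f y ≠ k) := by
  rcases Nat.even_or_odd' k with ⟨j, rfl | rfl⟩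
  -- The permutation 2, 4, …, 2j, 1, 3, …, 2j-1.
  · refine ⟨fun y => if y ≤ j then 2 * y else 2 * y - 2 * j - 1, ?_, ?_, ?_, ?_⟩ <;> intros <;>
      simp only <;> split_ifs <;> omega
  -- The permutation 2, 4, …, 2j, 1, 2j+1, 3, …, 2j-1; the largest entry is moved inside so as not
  -- to come last.
  · refine ⟨fun y => if y ≤ j then 2 * y else if y = j + 1 then 1 else
      if y = j + 2 then 2 * j + 1 else 2 * y - 2 * j - 3, ?_, ?_, ?_, ?_⟩ <;> intros <;>
      simp only <;> split_ifs <;> omega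

theorem outerMutualVisibilityNumber_eq_add_two (hm : 2 ≤ m) (hmn : m ≤ n)
    (h : m = 2 ∧ 3 ≤ n ∨ m = 3 ∧ 5 ≤ n ∨ m = 4 ∧ 7 ≤ n ∨ m = 5 ∧ 7 ≤ n ∨ 6 ≤ m) :
    (gridGraph n m).outerMutualVisibilityNumber = m + 2 := by
  refine le_antisymm (outerMutualVisibilityNumber_le fun X hX => hX.ncard_le) ?_
  rcases h with ⟨rfl, h⟩ | ⟨rfl, h⟩ | ⟨rfl, h⟩ | ⟨rfl, h⟩ | h
  · apply add_two_le_outerMutualVisibilityNumber h hm fun _ => 0 <;> intros <;> omega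
  · apply add_two_le_outerMutualVisibilityNumber (by omega) hm fun _ => 2 <;> intros <;> omega
  · apply add_two_le_outerMutualVisibilityNumber (by omega) hm fun y => 2 * y <;> intros <;> omega
  · apply add_two_le_outerMutualVisibilityNumber (by omega) hm
      (fun y => if y = 1 then 2 else if y = 2 then 5 else 3) <;> intros <;>
      split_ifs <;> omega
  · obtain ⟨f, h1, h2, h3, h4⟩ := exists_spread_permutation (m - 2) (by omega)
    refine add_two_le_outerMutualVisibilityNumber (by omega) hm f
      (fun y hy hy' => ?_) (fun y z hy hyz hz => h2 y z hy hyz (by omega))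
      (fun y z hy hyz hz => h3 y z hy hyz (by omega)) (fun y hy hy' he => ?_)
    · have := h1 y hy (by omega)
      omega
    -- `f y ≤ m - 2` and `f y ≠ m - 2` with `m ≤ n` keep `f y` off column `n - 2`.
    · have := h1 y hy (by omega)
      have := h4 y hy (by omega) (by omega)
      omega

/-- In each exceptional grid a failed search bounds the number above and an explicit sparse set
bounds it below. -/
theorem outerMutualVisibilityNumber_gridGraph_two_two :
    (gridGraph 2 2).outerMutualVisibilityNumber = 2 :=
  le_antisymm (outerMutualVisibilityNumber_le_of_canExtend (by decide +kernel))
    (le_outerMutualVisibilityNumber {(0, 0), (1, 0)}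
      (by decide +kernel) (by decide +kernel))

theorem outerMutualVisibilityNumber_gridGraph_three_three :
    (gridGraph 3 3).outerMutualVisibilityNumber = 4 :=
  le_antisymm (outerMutualVisibilityNumber_le_of_canExtend (by decide +kernel))
    (le_outerMutualVisibilityNumber {(0, 0), (0, 2), (2, 0), (2, 2)}
      (by decide +kernel) (by decide +kernel))

theorem outerMutualVisibilityNumber_gridGraph_four_three :
    (gridGraph 4 3).outerMutualVisibilityNumber = 4 :=
  le_antisymm (outerMutualVisibilityNumber_le_of_canExtend (by decide +kernel))
    (le_outerMutualVisibilityNumber {(0, 0), (0, 2), (3, 0), (3, 2)}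
      (by decide +kernel) (by decide +kernel))

theorem outerMutualVisibilityNumber_gridGraph_four_four :
    (gridGraph 4 4).outerMutualVisibilityNumber = 4 :=
  le_antisymm (outerMutualVisibilityNumber_le_of_canExtend (by decide +kernel))
    (le_outerMutualVisibilityNumber {(0, 0), (0, 3), (3, 0), (3, 3)}
      (by decide +kernel) (by decide +kernel))

theorem outerMutualVisibilityNumber_gridGraph_five_four :
    (gridGraph 5 4).outerMutualVisibilityNumber = 5 :=
  le_antisymm (outerMutualVisibilityNumber_le_of_canExtend (by decide +kernel))
    (le_outerMutualVisibilityNumber {(0, 0), (0, 3), (4, 0), (4, 3), (2, 1)}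
      (by decide +kernel) (by decide +kernel))

theorem outerMutualVisibilityNumber_gridGraph_five_five :
    (gridGraph 5 5).outerMutualVisibilityNumber = 5 :=
  le_antisymm (outerMutualVisibilityNumber_le_of_canExtend (by decide +kernel))
    (le_outerMutualVisibilityNumber {(0, 0), (0, 4), (4, 0), (4, 4), (2, 2)}
      (by decide +kernel) (by decide +kernel))

theorem outerMutualVisibilityNumber_gridGraph_six_four :
    (gridGraph 6 4).outerMutualVisibilityNumber = 5 :=
  le_antisymm (outerMutualVisibilityNumber_le_of_canExtend (by decide +kernel))
    (le_outerMutualVisibilityNumber {(0, 0), (0, 3), (5, 0), (5, 3), (2, 1)}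
      (by decide +kernel) (by decide +kernel))

theorem outerMutualVisibilityNumber_gridGraph_six_five :
    (gridGraph 6 5).outerMutualVisibilityNumber = 6 :=
  le_antisymm (outerMutualVisibilityNumber_le_of_canExtend (by decide +kernel))
    (le_outerMutualVisibilityNumber {(0, 0), (0, 4), (5, 0), (5, 4), (2, 1), (3, 3)}
      (by decide +kernel) (by decide +kernel))

end Number

end SimpleGraph

theorem mainTheorem2 (n m : ℕ) (hm : 2 ≤ m) (hmn : m ≤ n) :
    (SimpleGraph.gridGraph n m).outerMutualVisibilityNumber =
      if (n, m) = (2, 2) then 2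
      else if (n, m) ∈ ({(3, 2), (3, 3), (4, 3), (4, 4)} : Finset (ℕ × ℕ)) then 4
      else if (n, m) ∈ ({(5, 4), (5, 5), (6, 4)} : Finset (ℕ × ℕ)) then 5
      else if (n, m) = (6, 5) then 6
      else m + 2 := by
  simp only [Finset.mem_insert, Finset.mem_singleton, Prod.mk.injEq]
  split_ifs with h1 h2 h3 h4
  · obtain ⟨rfl, rfl⟩ := h1
    exact SimpleGraph.outerMutualVisibilityNumber_gridGraph_two_two
  · rcases h2 with ⟨rfl, rfl⟩ | ⟨rfl, rfl⟩ | ⟨rfl, rfl⟩ | ⟨rfl, rfl⟩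
    -- For `(3, 2)` the listed value 4 is `m + 2`, so the general construction applies.
    · exact SimpleGraph.outerMutualVisibilityNumber_eq_add_two hm hmn (by omega)
    · exact SimpleGraph.outerMutualVisibilityNumber_gridGraph_three_three
    · exact SimpleGraph.outerMutualVisibilityNumber_gridGraph_four_three
    · exact SimpleGraph.outerMutualVisibilityNumber_gridGraph_four_four
  · rcases h3 with ⟨rfl, rfl⟩ | ⟨rfl, rfl⟩ | ⟨rfl, rfl⟩
    · exact SimpleGraph.outerMutualVisibilityNumber_gridGraph_five_four
    · exact SimpleGraph.outerMutualVisibilityNumber_gridGraph_five_five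
    · exact SimpleGraph.outerMutualVisibilityNumber_gridGraph_six_four
  · obtain ⟨rfl, rfl⟩ := h4
    exact SimpleGraph.outerMutualVisibilityNumber_gridGraph_six_five
  · refine SimpleGraph.outerMutualVisibilityNumber_eq_add_two hm hmn ?_
    rcases Nat.lt_or_ge m 6 with h6 | h6
    · interval_cases m <;> omega
    · simp [h6]
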